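/- Let $\mathcal{T}=\{(p,q)\in[0,1]^2 : p+q<1,\ p\le q\}\setminus\{(0,0)\}$, and let $S:\mathcal{T}\to[0,1]$ be the BAC-function $$S(p,q)=\frac{\ln(1-p)-\ln q}{\ln(1-q)-\ln p}\quad (p\neq 0),\qquad S(0,q)=0 .$$ For real $r$ let $A(r)$ be the area (planar Lebesgue measure) of the region $R_r=\{(p,q)\in\mathcal{T} : 0<S(p,q)<r\}$. Then for all coprime positive integers $a<b$, with $r=a/b$, the region $R_r$ is measurable and $$A(r)=\int_0^1 \frac{b\,(x^a-1)^2\,x^{b-1}}{2\,(x^{a+b}-1)^2}\,dx ,$$ where the integral is a proper integral: its integrand extends from $[0,1)$ to a continuous function on $[0,1]$. In particular, $$A(1/2)=\frac13-\frac{\sqrt3\,\pi}{27}\qquad\text{and}\qquad A(1/3)=\frac38-\frac{3\pi}{32}.$$ -/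

import Mathlib

namespace BAC

/-- The parameter space `T = {(p,q) ∈ [0,1]² : p + q < 1, p ≤ q} \ {(0,0)}`. -/
def paramSpace : Set (ℝ × ℝ) :=
  {z | z.1 ∈ Set.Icc (0 : ℝ) 1 ∧ z.2 ∈ Set.Icc (0 : ℝ) 1 ∧ z.1 + z.2 < 1 ∧ z.1 ≤ z.2} \ {(0, 0)}

/-- The BAC-function `S`; it is only used at points of `paramSpace`, where for `p ≠ 0` all the
logarithms have positive arguments and the denominator is positive. -/
noncomputable def bacFunction (p q : ℝ) : ℝ :=
  if p = 0 then 0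
  else (Real.log (1 - p) - Real.log q) / (Real.log (1 - q) - Real.log p)

/-- The region `R_r = {(p,q) ∈ T : 0 < S(p,q) < r}`. -/
def region (r : ℝ) : Set (ℝ × ℝ) :=
  {z | z ∈ paramSpace ∧ 0 < bacFunction z.1 z.2 ∧ bacFunction z.1 z.2 < r}

/-- The area `A(r)` of `R_r`, its planar Lebesgue measure. -/
noncomputable def area (r : ℝ) : ℝ :=
  (MeasureTheory.volume (region r)).toReal

/-- The integrand `b (x^a - 1)² x^(b-1) / (2 (x^(a+b) - 1)²)`. -/
noncomputable def areaIntegrand (a b : ℕ) (x : ℝ) : ℝ :=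
  ((b : ℝ) * (x ^ a - 1) ^ 2 * x ^ (b - 1)) / (2 * (x ^ (a + b) - 1) ^ 2)

end BAC

namespace BAC

open MeasureTheory Set

/-! With X = p/(1-q) and Y = q/(1-p), the function S becomes log Y / log X. Writing X = x^b turns S
< a/b into the polynomial condition x^a < y, where y = Y (`bacFunction_lt_iff`). The condition p ≤ q
means X ≤ Y, which is automatic there because a < b. So `chart b` maps {x^a < y < 1} bijectively
onto the region (`image_chart`). Integrating its Jacobian over y gives the integrand in closed form
(`integral_chartJacobian`), and Fubini yields the area formula. -/

/-- For `p ≠ 0`, the pair `(X, Y)` with `X = p / (1 - q)` and `Y = q / (1 - p)` determines `(p, q)`;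
this is the inverse map, with `X` replaced by `x ^ b`. -/
noncomputable def chart (b : ℕ) (z : ℝ × ℝ) : ℝ × ℝ :=
  (z.1 ^ b * (1 - z.2) * (1 - z.1 ^ b * z.2)⁻¹, z.2 * (1 - z.1 ^ b) * (1 - z.1 ^ b * z.2)⁻¹)

/-- The points `(x, y)` that `chart b` sends to the region `R_{a/b}`. -/
def chartDomain (a : ℕ) : Set (ℝ × ℝ) :=
  {z | z.1 ∈ Ioo (0 : ℝ) 1 ∧ z.2 ∈ Ioo (z.1 ^ a) 1}

/-- The Jacobian determinant of `chart b`. -/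
noncomputable def chartJacobian (b : ℕ) (x y : ℝ) : ℝ :=
  b * x ^ (b - 1) * (1 - x ^ b) * (1 - y) / (1 - x ^ b * y) ^ 3

/-- The Fréchet derivative of `chart b`. -/
noncomputable def chartDeriv (b : ℕ) (z : ℝ × ℝ) : ℝ × ℝ →L[ℝ] ℝ × ℝ :=
  (Matrix.toLin (.finTwoProd ℝ) (.finTwoProd ℝ)
    !![b * z.1 ^ (b - 1) * (1 - z.2) / (1 - z.1 ^ b * z.2) ^ 2,
        -(z.1 ^ b * (1 - z.1 ^ b)) / (1 - z.1 ^ b * z.2) ^ 2;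
      -(b * z.1 ^ (b - 1) * z.2 * (1 - z.2)) / (1 - z.1 ^ b * z.2) ^ 2,
        (1 - z.1 ^ b) / (1 - z.1 ^ b * z.2) ^ 2]).toContinuousLinearMap

/-! ### Differential and injectivity of the chart -/

theorem hasFDerivAt_chart (b : ℕ) {z : ℝ × ℝ} (hz : 1 - z.1 ^ b * z.2 ≠ 0) :
    HasFDerivAt (chart b) (chartDeriv b z) z := by
  have hX : HasFDerivAt (fun w : ℝ × ℝ => w.1 ^ b)
      ((b * z.1 ^ (b - 1)) • ContinuousLinearMap.fst ℝ ℝ ℝ) z :=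
    (hasDerivAt_pow b z.1).comp_hasFDerivAt z hasFDerivAt_fst
  have hY : HasFDerivAt (fun w : ℝ × ℝ => w.2) (ContinuousLinearMap.snd ℝ ℝ ℝ) z :=
    hasFDerivAt_snd
  have hinv := (hasDerivAt_inv hz).comp_hasFDerivAt z ((hX.mul hY).const_sub 1)
  unfold chartDeriv
  rw [Matrix.toLin_finTwoProd_toContinuousLinearMap]
  refine HasFDerivAt.prodMk ?_ ?_
  · refine ((hX.mul (hY.const_sub 1)).mul hinv).congr_fderiv ?_
    ext <;> simp <;> field_simp <;> ring
  · refine ((hY.mul (hX.const_sub 1)).mul hinv).congr_fderiv ?_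
    ext <;> simp <;> field_simp <;> ring

theorem det_chartDeriv (b : ℕ) (z : ℝ × ℝ) :
    (chartDeriv b z).det = chartJacobian b z.1 z.2 := by
  unfold chartDeriv chartJacobian
  simp only [LinearMap.det_toContinuousLinearMap, LinearMap.det_toLin, Matrix.det_fin_two_of]
  field_simp

theorem pow_mul_lt_one {b : ℕ} {x y : ℝ} (hx : x ∈ Ioo (0 : ℝ) 1) (hy : y < 1) :
    x ^ b * y < 1 := by
  have h0 : 0 < x ^ b := pow_pos hx.1 b
  have h1 : x ^ b ≤ 1 := pow_le_one₀ hx.1.le hx.2.le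
  nlinarith

theorem injOn_chart (a : ℕ) {b : ℕ} (hb : b ≠ 0) : InjOn (chart b) (chartDomain a) := by
  have key : ∀ z ∈ chartDomain a,
      (chart b z).1 / (1 - (chart b z).2) = z.1 ^ b ∧ (chart b z).2 / (1 - (chart b z).1) = z.2 := by
    rintro ⟨x, y⟩ ⟨hx, hy⟩
    have hd : 1 - x ^ b * y ≠ 0 := (sub_pos.2 (pow_mul_lt_one hx hy.2)).ne'
    have hd' : 1 - y * x ^ b ≠ 0 := by rwa [mul_comm]
    have hX : 1 - x ^ b ≠ 0 := (sub_pos.2 (pow_lt_one₀ hx.1.le hx.2 hb)).ne'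
    have hY : 1 - y ≠ 0 := (sub_pos.2 hy.2).ne'
    have h1 : 1 - (chart b (x, y)).1 = (1 - x ^ b) * (1 - x ^ b * y)⁻¹ := by
      simp only [chart]; field_simp; ring
    have h2 : 1 - (chart b (x, y)).2 = (1 - y) * (1 - x ^ b * y)⁻¹ := by
      simp only [chart]; field_simp; ring
    rw [h1, h2]
    simp only [chart]
    constructor <;> field_simp
  intro z hz w hw h
  have hz' := key z hz
  have hw' := key w hw
  rw [h] at hz'
  exact Prod.ext ((pow_left_inj₀ hz.1.1.le hw.1.1.le hb).1 (hz'.1.symm.trans hw'.1))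
    (hz'.2.symm.trans hw'.2)

/-! ### The region in the new coordinates -/

/-- Since p + q < 1, both log differences in S are positive once p > 0, while S = 0 at p = 0. -/
theorem mem_region_iff {r : ℝ} {z : ℝ × ℝ} :
    z ∈ region r ↔ 0 < z.1 ∧ z.1 ≤ z.2 ∧ z.1 + z.2 < 1 ∧ bacFunction z.1 z.2 < r := by
  obtain ⟨p, q⟩ := z
  constructor
  · rintro ⟨⟨⟨⟨hp, -⟩, -, hpq, hle⟩, -⟩, hS, hr⟩
    refine ⟨lt_of_le_of_ne hp ?_, hle, hpq, hr⟩
    rintro rfl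
    simp [bacFunction] at hS
  · rintro ⟨hp, hle, hpq, hr⟩
    simp only at hp hle hpq hr
    refine ⟨⟨⟨⟨hp.le, by linarith⟩, ⟨by linarith, by linarith⟩, hpq, hle⟩, ?_⟩, ?_, hr⟩
    · simp only [mem_singleton_iff, Prod.mk.injEq, not_and]
      intro h
      exact absurd h hp.ne'
    · simp only [bacFunction, hp.ne', if_false]
      exact div_pos (sub_pos.2 (Real.log_lt_log (by linarith) (by linarith)))
        (sub_pos.2 (Real.log_lt_log hp (by linarith)))

theorem bacFunction_lt_iff {a b : ℕ} (hb : 0 < b) {p q x y : ℝ} (hp : 0 < p) (hq : 0 < q)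
    (hpq : p + q < 1) (hx : 0 < x) (hX : p = x ^ b * (1 - q)) (hY : q = y * (1 - p)) :
    bacFunction p q < a / b ↔ x ^ a < y := by
  have hp1 : 0 < 1 - p := by linarith
  have hq1 : 0 < 1 - q := by linarith
  have hy : 0 < y := pos_of_mul_pos_left (hY ▸ hq) hp1.le
  have hb' : (0 : ℝ) < b := by exact_mod_cast hb
  have hlp : Real.log p = b * Real.log x + Real.log (1 - q) := by
    conv_lhs => rw [hX, Real.log_mul (pow_pos hx b).ne' hq1.ne', Real.log_pow]
  have hlq : Real.log q = Real.log y + Real.log (1 - p) := by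
    conv_lhs => rw [hY, Real.log_mul hy.ne' hp1.ne']
  have hden : 0 < Real.log (1 - q) - Real.log p :=
    sub_pos.2 (Real.log_lt_log hp (by linarith))
  simp only [bacFunction, hp.ne', if_false]
  rw [div_lt_div_iff₀ hden hb', ← Real.log_lt_log_iff (pow_pos hx a) hy, Real.log_pow, hlp, hlq]
  have e : (Real.log (1 - p) - (Real.log y + Real.log (1 - p))) * b = b * -Real.log y := by ring
  have e' : a * (Real.log (1 - q) - (b * Real.log x + Real.log (1 - q))) =
      b * -(a * Real.log x) := by ring
  rw [e, e', mul_lt_mul_iff_right₀ hb', neg_lt_neg_iff]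

theorem image_chart {a b : ℕ} (hab : a < b) : chart b '' chartDomain a = region (a / b) := by
  have hb : 0 < b := by omega
  ext ⟨p, q⟩
  rw [mem_region_iff]
  constructor
  · rintro ⟨⟨x, y⟩, ⟨hx, hy⟩, h⟩
    simp only [chart, Prod.mk.injEq] at h hx hy
    obtain ⟨rfl, rfl⟩ := h
    have hd : 0 < 1 - x ^ b * y := sub_pos.2 (pow_mul_lt_one hx hy.2)
    have hd' : 1 - y * x ^ b ≠ 0 := by rw [mul_comm]; exact hd.ne'
    have hX0 : 0 < x ^ b := pow_pos hx.1 b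
    have hX : 0 < 1 - x ^ b := sub_pos.2 (pow_lt_one₀ hx.1.le hx.2 hb.ne')
    have hY : 0 < 1 - y := sub_pos.2 hy.2
    have hy0 : 0 < y := (pow_pos hx.1 a).trans hy.1
    have hle : x ^ b ≤ y := (pow_le_pow_of_le_one hx.1.le hx.2.le hab.le).trans hy.1.le
    have hpq : x ^ b * (1 - y) * (1 - x ^ b * y)⁻¹ + y * (1 - x ^ b) * (1 - x ^ b * y)⁻¹ < 1 := by
      rw [← add_mul, ← div_eq_mul_inv, div_lt_one hd]
      -- With X = x^b, (1 - Xy) - X(1-y) - y(1-X) = (1-X)(1-y).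
      nlinarith [mul_pos hX hY]
    refine ⟨by positivity, ?_, hpq, ?_⟩
    · exact mul_le_mul_of_nonneg_right (by nlinarith) (inv_pos.2 hd).le
    · refine (bacFunction_lt_iff hb (by positivity) (by positivity) hpq hx.1 ?_ ?_).2 hy.1 <;>
        field_simp <;> ring
  · rintro ⟨hp, hle, hpq, hr⟩
    simp only at hp hle hpq hr
    have hq : 0 < q := hp.trans_le hle
    have hp1 : 0 < 1 - p := by linarith
    have hq1 : 0 < 1 - q := by linarith
    obtain ⟨x, hx0, hxb⟩ : ∃ x : ℝ, 0 < x ∧ x ^ b = p / (1 - q) :=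
      ⟨(p / (1 - q)) ^ ((b : ℝ)⁻¹), Real.rpow_pos_of_pos (div_pos hp hq1) _,
        Real.rpow_inv_natCast_pow (div_pos hp hq1).le hb.ne'⟩
    have hx1 : x < 1 := by
      rw [← pow_lt_one_iff_of_nonneg hx0.le hb.ne', hxb, div_lt_one hq1]
      linarith
    have hxy := (bacFunction_lt_iff (a := a) (y := q / (1 - p)) hb hp hq hpq hx0
      (by rw [hxb]; field_simp) (by field_simp)).1 hr
    have hy1 : q / (1 - p) < 1 := (div_lt_one hp1).2 (by linarith)
    refine ⟨(x, q / (1 - p)), ⟨⟨hx0, hx1⟩, hxy, hy1⟩, ?_⟩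
    have hd : (1 - q) * (1 - p) - p * q ≠ 0 := by
      have : (1 - q) * (1 - p) - p * q = 1 - (p + q) := by ring
      rw [this]
      exact (sub_pos.2 hpq).ne'
    have hd' : 1 - p / (1 - q) * (q / (1 - p)) = ((1 - q) * (1 - p) - p * q) / ((1 - q) * (1 - p)) := by
      field_simp
    have hd₂ : 1 - q - p ≠ 0 := by linarith
    simp only [chart, hxb, hd', Prod.mk.injEq]
    constructor
    · field_simp
      ring_nf
    · field_simp
      ring_nf
      field_simp
      ring

/-! ### Measurability and integration -/

theorem measurableSet_region (r : ℝ) : MeasurableSet (region r) := by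
  have hS : Measurable fun z : ℝ × ℝ => bacFunction z.1 z.2 := by
    refine Measurable.ite (measurableSet_eq_fun measurable_fst measurable_const)
      measurable_const ?_
    fun_prop
  have : region r = {z | 0 < z.1 ∧ z.1 ≤ z.2 ∧ z.1 + z.2 < 1 ∧ bacFunction z.1 z.2 < r} :=
    ext fun _ => mem_region_iff
  rw [this]
  exact (measurableSet_lt measurable_const measurable_fst).inter
    ((measurableSet_le measurable_fst measurable_snd).inter
      ((measurableSet_lt (measurable_fst.add measurable_snd) measurable_const).inter
        (measurableSet_lt hS measurable_const)))

theorem measurableSet_chartDomain (a : ℕ) : MeasurableSet (chartDomain a) :=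
  ((measurableSet_lt measurable_const measurable_fst).inter
    (measurableSet_lt measurable_fst measurable_const)).inter
    ((measurableSet_lt (measurable_fst.pow_const a) measurable_snd).inter
      (measurableSet_lt measurable_snd measurable_const))

theorem volume_region_ne_top (r : ℝ) : volume (region r) ≠ ⊤ := by
  have h : region r ⊆ Icc (0 : ℝ) 1 ×ˢ Icc (0 : ℝ) 1 := fun z hz => ⟨hz.1.1.1, hz.1.1.2.1⟩
  exact ((measure_mono h).trans_lt (isCompact_Icc.prod isCompact_Icc).measure_lt_top).ne

theorem integral_chartJacobian {a b : ℕ} (ha : 0 < a) (hb : 0 < b) {x : ℝ}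
    (hx : x ∈ Ioo (0 : ℝ) 1) :
    ∫ y in Ioo (x ^ a) 1, chartJacobian b x y = areaIntegrand a b x := by
  have hxa : x ^ a < 1 := pow_lt_one₀ hx.1.le hx.2 ha.ne'
  have hX : 1 - x ^ b ≠ 0 := (sub_pos.2 (pow_lt_one₀ hx.1.le hx.2 hb.ne')).ne'
  have hd : ∀ y ∈ uIcc (x ^ a) 1, 1 - x ^ b * y ≠ 0 := by
    intro y hy
    rw [uIcc_of_le hxa.le] at hy
    have h0 := pow_pos hx.1 b
    have h1 := pow_lt_one₀ hx.1.le hx.2 hb.ne'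
    have := mul_le_mul_of_nonneg_left hy.2 h0.le
    apply ne_of_gt
    linarith
  rw [← integral_Ioc_eq_integral_Ioo, ← intervalIntegral.integral_of_le hxa.le,
    intervalIntegral.integral_eq_sub_of_hasDerivAt
      -- This antiderivative vanishes at y = 1, so only the endpoint x^a contributes.
      (f := fun y => -(b * x ^ (b - 1) / 2) * ((1 - y) ^ 2 / (1 - x ^ b * y) ^ 2))]
  · have h2 : 1 - x ^ (a + b) ≠ 0 := by
      have := pow_lt_one₀ hx.1.le hx.2 (by omega : a + b ≠ 0)
      exact (sub_pos.2 this).ne'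
    have h3 : x ^ (a + b) - 1 ≠ 0 := by
      rw [← neg_sub]; exact neg_ne_zero.2 h2
    have e : x ^ b * x ^ a = x ^ (a + b) := by ring
    have e2 : (1 - x ^ (a + b)) ^ 2 = (x ^ (a + b) - 1) ^ 2 := by ring
    simp only [areaIntegrand, e, e2]
    field_simp
    ring
  · intro y hy
    have hd' := hd y hy
    have hd'' : 1 - y * x ^ b ≠ 0 := by rwa [mul_comm]
    have h1 : HasDerivAt (fun y : ℝ => (1 - y) ^ 2) _ y :=
      ((hasDerivAt_id y).const_sub 1).pow 2
    have h2 : HasDerivAt (fun y : ℝ => (1 - x ^ b * y) ^ 2) _ y :=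
      (((hasDerivAt_id y).const_mul (x ^ b)).const_sub 1).pow 2
    refine ((h1.div h2 (pow_ne_zero 2 hd')).const_mul (-(b * x ^ (b - 1) / 2))).congr_deriv ?_
    simp only [chartJacobian, id]
    field_simp
    ring
  · apply ContinuousOn.intervalIntegrable
    unfold chartJacobian
    exact ContinuousOn.div (by fun_prop) (by fun_prop) fun y hy => pow_ne_zero 3 (hd y hy)

theorem area_eq_integral {a b : ℕ} (ha : 0 < a) (hab : a < b) :
    area (a / b) = ∫ x in (0 : ℝ)..1, areaIntegrand a b x := by
  have hb : 0 < b := by omega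
  have hD := measurableSet_chartDomain a
  have hd : ∀ z ∈ chartDomain a, 0 < 1 - z.1 ^ b * z.2 := fun z hz =>
    sub_pos.2 (pow_mul_lt_one hz.1 hz.2.2)
  have hderiv : ∀ z ∈ chartDomain a, HasFDerivWithinAt (chart b) (chartDeriv b z) (chartDomain a) z :=
    fun z hz => (hasFDerivAt_chart b (hd z hz).ne').hasFDerivWithinAt
  have hJ : ∀ z ∈ chartDomain a,
      |(chartDeriv b z).det| • (1 : ℝ) = chartJacobian b z.1 z.2 := by
    intro z hz
    have h1 := sub_pos.2 (pow_lt_one₀ hz.1.1.le hz.1.2 hb.ne')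
    have h2 := sub_pos.2 hz.2.2
    have h3 := hd z hz
    have h4 := hz.1.1
    rw [det_chartDeriv b z, abs_of_nonneg (by unfold chartJacobian; positivity), smul_eq_mul,
      mul_one]
  -- Fubini needs integrability; it transfers through the chart from the constant 1 on the region,
  -- which has finite area.
  have hint : IntegrableOn (fun z : ℝ × ℝ => chartJacobian b z.1 z.2) (chartDomain a) := by
    refine IntegrableOn.congr_fun ?_ hJ hD
    rw [← integrableOn_image_iff_integrableOn_abs_det_fderiv_smul volume hD hderiv
      (injOn_chart a hb.ne') (fun _ => (1 : ℝ)), image_chart hab]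
    exact integrableOn_const (volume_region_ne_top _)
  have harea : area (a / b) = ∫ z in chartDomain a, chartJacobian b z.1 z.2 := by
    rw [← setIntegral_congr_fun hD hJ, ← integral_image_eq_integral_abs_det_fderiv_smul volume hD
      hderiv (injOn_chart a hb.ne') (fun _ => (1 : ℝ)), image_chart hab]
    simp [area, Measure.real]
  rw [harea, ← integral_indicator hD, Measure.volume_eq_prod, integral_prod _
    (by rw [← Measure.volume_eq_prod]; exact hint.integrable_indicator hD),
    intervalIntegral.integral_of_le zero_le_one, integral_Ioc_eq_integral_Ioo,
    ← integral_indicator measurableSet_Ioo]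
  congr 1
  ext x
  by_cases hx : x ∈ Ioo (0 : ℝ) 1
  · rw [indicator_of_mem hx, ← integral_chartJacobian ha hb hx, ← integral_indicator measurableSet_Ioo]
    congr 1
    ext y
    by_cases hy : y ∈ Ioo (x ^ a) 1
    · rw [indicator_of_mem hy, indicator_of_mem (show (x, y) ∈ chartDomain a from ⟨hx, hy⟩)]
    · rw [indicator_of_notMem hy, indicator_of_notMem fun h : (x, y) ∈ chartDomain a => hy h.2]
  · rw [indicator_of_notMem hx]
    refine integral_eq_zero_of_ae (Filter.Eventually.of_forall fun y => ?_)
    exact indicator_of_notMem (fun h : (x, y) ∈ chartDomain a => hx h.1) _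

/-! ### Removing the singularity at 1 -/

/-- The continuous extension to `[0, 1]` of the integrand, after division by `(x - 1) ^ 2`. -/
noncomputable def areaIntegrandExt (a b : ℕ) (x : ℝ) : ℝ :=
  (b * (∑ i ∈ Finset.range a, x ^ i) ^ 2 * x ^ (b - 1)) /
    (2 * (∑ i ∈ Finset.range (a + b), x ^ i) ^ 2)

theorem continuousOn_areaIntegrandExt {a b : ℕ} (hb : 0 < b) :
    ContinuousOn (areaIntegrandExt a b) (Icc 0 1) := by
  refine ContinuousOn.div (by fun_prop) (by fun_prop) fun x hx => ?_
  have h : 0 < ∑ i ∈ Finset.range (a + b), x ^ i := by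
    refine Finset.sum_pos' (fun i _ => pow_nonneg hx.1 i) ⟨0, ?_, by simp⟩
    simp
    omega
  positivity

theorem areaIntegrand_eq_ext (a b : ℕ) {x : ℝ} (hx : x ≠ 1) :
    areaIntegrand a b x = areaIntegrandExt a b x := by
  have h : (x - 1) ^ 2 ≠ 0 := pow_ne_zero 2 (sub_ne_zero.2 hx)
  unfold areaIntegrand areaIntegrandExt
  rw [← geom_sum_mul x a, ← geom_sum_mul x (a + b), eq_comm, ← mul_div_mul_right _ _ h]
  congr 1 <;> ring

/-- The functions may differ only at x = 1, a null set. -/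
theorem integral_areaIntegrand_eq_ext (a b : ℕ) :
    ∫ x in (0 : ℝ)..1, areaIntegrand a b x = ∫ x in (0 : ℝ)..1, areaIntegrandExt a b x := by
  rw [intervalIntegral.integral_of_le zero_le_one, intervalIntegral.integral_of_le zero_le_one,
    integral_Ioc_eq_integral_Ioo, integral_Ioc_eq_integral_Ioo]
  exact setIntegral_congr_fun measurableSet_Ioo fun x hx => areaIntegrand_eq_ext a b hx.2.ne

theorem integral_areaIntegrandExt_of_hasDerivAt {a b : ℕ} (hb : 0 < b) {F : ℝ → ℝ}
    (hF : ∀ x ∈ Icc (0 : ℝ) 1, HasDerivAt F (areaIntegrandExt a b x) x) :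
    ∫ x in (0 : ℝ)..1, areaIntegrandExt a b x = F 1 - F 0 := by
  have hI : uIcc (0 : ℝ) 1 = Icc 0 1 := uIcc_of_le zero_le_one
  refine intervalIntegral.integral_eq_sub_of_hasDerivAt (by rwa [hI]) ?_
  exact ContinuousOn.intervalIntegrable (by rw [hI]; exact continuousOn_areaIntegrandExt hb)

/-! ### Explicit values -/

theorem area_one_half : area (1 / 2) = 1 / 3 - Real.sqrt 3 * Real.pi / 27 := by
  have h := area_eq_integral (a := 1) (b := 2) one_pos one_lt_two
  rw [Nat.cast_one, Nat.cast_ofNat] at h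
  have hs : √(3 : ℝ) ^ 2 = 3 := Real.sq_sqrt (by norm_num)
  have hs0 : √(3 : ℝ) ≠ 0 := by positivity
  rw [h, integral_areaIntegrand_eq_ext, integral_areaIntegrandExt_of_hasDerivAt two_pos
    -- A primitive of x/(x²+x+1)².
    (F := fun x => -(x + 2) / (3 * (x ^ 2 + x + 1)) -
      2 * √3 / 9 * Real.arctan ((2 * x + 1) / √3))]
  · have e1 : Real.arctan ((2 * 1 + 1) / √3) = Real.pi / 3 := by
      rw [← Real.arctan_sqrt_three]
      congr 1
      field_simp
      linarith
    have e0 : Real.arctan ((2 * 0 + 1) / √3) = Real.pi / 6 := by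
      rw [← Real.arctan_inv_sqrt_three]
      congr 1
      simp
    simp only [e1, e0]
    ring
  · intro x hx
    have hx0 : 0 ≤ x := hx.1
    have hq : 0 < x ^ 2 + x + 1 := by positivity
    have h1 : HasDerivAt (fun x : ℝ => -(x + 2)) (-1) x := ((hasDerivAt_id x).add_const 2).neg
    have h2 : HasDerivAt (fun x : ℝ => 3 * (x ^ 2 + x + 1)) (3 * (2 * x + 1)) x := by
      simpa using (((hasDerivAt_pow 2 x).add (hasDerivAt_id x)).add_const 1).const_mul 3
    have h3 : HasDerivAt (fun x : ℝ => (2 * x + 1) / √3) (2 / √3) x := by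
      simpa using (((hasDerivAt_id x).const_mul 2).add_const 1).div_const √3
    refine ((h1.div h2 (by positivity)).sub (h3.arctan.const_mul (2 * √3 / 9))).congr_deriv ?_
    have e : 1 + ((2 * x + 1) / √3) ^ 2 = 4 * (x ^ 2 + x + 1) / 3 := by
      rw [div_pow, hs]; ring
    rw [e]
    have e2 : ∑ i ∈ Finset.range (1 + 2), x ^ i = x ^ 2 + x + 1 := by
      simp only [Finset.sum_range_succ, Finset.sum_range_zero]
      ring
    simp only [areaIntegrandExt, e2, Finset.sum_range_one]
    norm_num
    field_simp
    ring

theorem area_one_third : area (1 / 3) = 3 / 8 - 3 * Real.pi / 32 := by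
  have h := area_eq_integral (a := 1) (b := 3) one_pos (by norm_num)
  rw [Nat.cast_one, Nat.cast_ofNat] at h
  rw [h, integral_areaIntegrand_eq_ext, integral_areaIntegrandExt_of_hasDerivAt three_pos
    -- From the partial fractions of 3x²/(2(x+1)²(x²+1)²), which leave no logarithm.
    (F := fun x => -(3 / 8) * (Real.arctan x + (x ^ 2 + 1)⁻¹ + (x + 1)⁻¹))]
  · simp only [Real.arctan_one, Real.arctan_zero]
    ring
  · intro x hx
    have hx0 : 0 ≤ x := hx.1
    have h1 : HasDerivAt (fun x : ℝ => x ^ 2 + 1) (2 * x) x := by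
      simpa using (hasDerivAt_pow 2 x).add_const 1
    have h2 : HasDerivAt (fun x : ℝ => x + 1) 1 x := (hasDerivAt_id x).add_const 1
    refine ((((Real.hasDerivAt_arctan x).add (h1.inv (by positivity))).add
      (h2.inv (by positivity))).const_mul (-(3 / 8))).congr_deriv ?_
    have e : ∑ i ∈ Finset.range (1 + 3), x ^ i = (x + 1) * (x ^ 2 + 1) := by
      simp only [Finset.sum_range_succ, Finset.sum_range_zero]
      ring
    simp only [areaIntegrandExt, e, Finset.sum_range_one]
    norm_num
    rw [show 1 + x ^ 2 = x ^ 2 + 1 by ring]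
    field_simp
    ring

end BAC

theorem mainTheorem6 :
    (∀ a b : ℕ, 0 < a → a < b → Nat.Coprime a b →
      MeasurableSet (BAC.region ((a : ℝ) / (b : ℝ))) ∧
      (∃ g : ℝ → ℝ, ContinuousOn g (Set.Icc 0 1) ∧
        Set.EqOn (BAC.areaIntegrand a b) g (Set.Ico 0 1)) ∧
      BAC.area ((a : ℝ) / (b : ℝ)) = ∫ x in (0 : ℝ)..1, BAC.areaIntegrand a b x) ∧
    BAC.area (1 / 2) = 1 / 3 - Real.sqrt 3 * Real.pi / 27 ∧
    BAC.area (1 / 3) = 3 / 8 - 3 * Real.pi / 32 :=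
  ⟨fun a b ha hab _ => ⟨BAC.measurableSet_region _,
    ⟨BAC.areaIntegrandExt a b, BAC.continuousOn_areaIntegrandExt (ha.trans hab),
      fun _ hx => BAC.areaIntegrand_eq_ext a b hx.2.ne⟩,
    BAC.area_eq_integral ha hab⟩, BAC.area_one_half, BAC.area_one_third⟩
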